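/- Let $P$ be a closed polygonal curve (a simple closed polygon) embedded in $\mathbb{R}^3$, and let $g(K)$ be the genus of its knot type $K$, that is, the least genus of a compact connected orientable PL surface embedded in $\mathbb{R}^3$ whose boundary is a closed polygonal curve ambient isotopic to $P$. Let $S$ be a compact triangulated oriented PL surface, not necessarily connected, which is embedded in $\mathbb{R}^3$ (with flat triangles) and whose boundary is a subdivision of $P$. If $t$ is the number of triangles of $S$, then $$t \ge 4g(K)+1.$$ -/

import Mathlib

/-- The number of triangles of `S` that contain the face `e`. -/
noncomputable def triangleDegree {E : Type*} [AddCommGroup E] [Module ℝ E]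
    (S : Geometry.SimplicialComplex ℝ E) (e : Finset E) : ℕ :=
  {s | s ∈ S.faces ∧ s.card = 3 ∧ e ⊆ s}.ncard

/-- The number of `k`-dimensional faces of `S`. -/
noncomputable def faceCount {E : Type*} [AddCommGroup E] [Module ℝ E]
    (S : Geometry.SimplicialComplex ℝ E) (k : ℕ) : ℕ :=
  {s | s ∈ S.faces ∧ s.card = k + 1}.ncard

/-- The number of triangles of `S`. -/
noncomputable def triangleCount {E : Type*} [AddCommGroup E] [Module ℝ E]
    (S : Geometry.SimplicialComplex ℝ E) : ℕ :=
  faceCount S 2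

/-- The Euler characteristic `V - E + F` of a two-dimensional complex. -/
noncomputable def eulerChar {E : Type*} [AddCommGroup E] [Module ℝ E]
    (S : Geometry.SimplicialComplex ℝ E) : ℤ :=
  (faceCount S 0 : ℤ) - faceCount S 1 + faceCount S 2

open scoped Classical in
/-- The link of the vertex `v`, as a graph: its vertices are the `w` for which `{v, w}` is an edge
of `S`, and `w`, `w'` are adjacent when `{v, w, w'}` is a triangle of `S`. -/
def linkGraph {E : Type*} [AddCommGroup E] [Module ℝ E]
    (S : Geometry.SimplicialComplex ℝ E) (v : E) :
    SimpleGraph {w : E // w ≠ v ∧ ({v, w} : Finset E) ∈ S.faces} where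
  Adj w w' := w ≠ w' ∧ ({v, w.1, w'.1} : Finset E) ∈ S.faces
  symm := ⟨by
    rintro w w' ⟨h, h'⟩
    refine ⟨h.symm, ?_⟩
    rwa [Finset.pair_comm]⟩
  loopless := ⟨fun _ h => h.1 rfl⟩

/-- `S` is a compact triangulated PL surface, possibly with boundary and possibly disconnected,
embedded in `E`. Every face lies in a triangle, every edge lies in one or two triangles, and the
link of every vertex is connected; so the link of each vertex is a path (of at least one edge) or a
cycle. Embeddedness is part of `S` being a geometric simplicial complex in `E`. -/
structure IsPLSurface {E : Type*} [AddCommGroup E] [Module ℝ E]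
    (S : Geometry.SimplicialComplex ℝ E) : Prop where
  finite : S.faces.Finite
  card_le : ∀ s ∈ S.faces, s.card ≤ 3
  pure : ∀ s ∈ S.faces, ∃ t ∈ S.faces, t.card = 3 ∧ s ⊆ t
  edge : ∀ e ∈ S.faces, e.card = 2 → triangleDegree S e = 1 ∨ triangleDegree S e = 2
  link : ∀ v ∈ S.vertices, (linkGraph S v).Connected

/-- `o` is an orientation of the triangulated surface `S`: it assigns to each triangle a cyclic
order of its three vertices (a 3-cycle with support the triangle), so that two distinct triangles
with a common edge `{a, b}` traverse this edge in opposite directions. -/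
structure IsOrientation {E : Type*} [AddCommGroup E] [Module ℝ E]
    (S : Geometry.SimplicialComplex ℝ E) (o : Finset E → Equiv.Perm E) : Prop where
  isCycle : ∀ s ∈ S.faces, s.card = 3 → (o s).IsCycle
  support : ∀ s ∈ S.faces, s.card = 3 → ∀ x, o s x ≠ x ↔ x ∈ s
  coherent : ∀ s ∈ S.faces, ∀ t ∈ S.faces, s.card = 3 → t.card = 3 → s ≠ t →
    ∀ a b, a ≠ b → a ∈ s → b ∈ s → a ∈ t → b ∈ t → (o s a = b ↔ o t b = a)

/-- The boundary of a triangulated surface: the edges that lie in exactly one triangle, together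
with their vertices. -/
def boundaryComplex {E : Type*} [AddCommGroup E] [Module ℝ E]
    (S : Geometry.SimplicialComplex ℝ E) : Geometry.SimplicialComplex ℝ E where
  faces := {s | s.Nonempty ∧ ∃ e ∈ S.faces, e.card = 2 ∧ triangleDegree S e = 1 ∧ s ⊆ e}
  isRelLowerSet_faces := by
    rintro s ⟨hs, e, he, hc, hd, hse⟩
    exact ⟨hs, fun t hts ht => ⟨ht, e, he, hc, hd, Finset.Subset.trans hts hse⟩⟩
  indep := by
    rintro s ⟨hs, e, he, -, -, hse⟩
    exact S.indep (S.down_closed he hse hs)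
  inter_subset_convexHull := by
    rintro s t ⟨hs, e, he, -, -, hse⟩ ⟨ht, f, hf, -, -, htf⟩
    exact S.inter_subset_convexHull (S.down_closed he hse hs) (S.down_closed hf htf ht)

/-- The number of connected components of the boundary of `S`. -/
noncomputable def boundaryComponents {E : Type*} [AddCommGroup E] [Module ℝ E] [TopologicalSpace E]
    (S : Geometry.SimplicialComplex ℝ E) : ℕ :=
  Nat.card (ConnectedComponents (boundaryComplex S).space)

/-- The genus `g` of a compact connected orientable surface with `b` boundary components,
determined by `χ = 2 - 2 g - b`. (For such surfaces this number is a natural number; it is written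
as a real number so that no rounding takes place in the definition.) -/
noncomputable def surfaceGenus {E : Type*} [AddCommGroup E] [Module ℝ E] [TopologicalSpace E]
    (S : Geometry.SimplicialComplex ℝ E) : ℝ :=
  (2 - eulerChar S - boundaryComponents S) / 2

/-- The closed polygonal curve `P` is embedded: it has at least three vertices, these are distinct,
and two different edges meet at most in common endpoints. -/
structure IsEmbeddedPolygon {E : Type*} [AddCommGroup E] [Module ℝ E] {n : ℕ}
    (P : Polygon E n) : Prop where
  three_le : 3 ≤ n
  injective : Function.Injective P.vertices
  inter : ∀ i j, i ≠ j → P.edgeSet ℝ i ∩ P.edgeSet ℝ j ⊆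
    {P i, P (finRotate n i)} ∩ {P j, P (finRotate n j)}

/-- The complex `L` is a subdivision of the closed polygonal curve `P`: both have the same
underlying set, and every simplex of `L` is contained in an edge of `P`. -/
def IsSubdivisionOf {E : Type*} [AddCommGroup E] [Module ℝ E] {n : ℕ}
    (L : Geometry.SimplicialComplex ℝ E) (P : Polygon E n) : Prop :=
  L.space = P.boundary ℝ ∧
    ∀ s ∈ L.faces, ∃ i, convexHull ℝ (s : Set E) ⊆ P.edgeSet ℝ i

/-- `A` is carried onto `B` by an ambient isotopy of `X`. -/
def AmbientIsotopic {X : Type*} [TopologicalSpace X] (A B : Set X) : Prop :=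
  ∃ Φ : unitInterval → (X ≃ₜ X), Continuous (fun q : unitInterval × X => Φ q.1 q.2) ∧
    (∀ x, Φ 0 x = x) ∧ Φ 1 '' A = B

/-- The genus of the knot type of the closed polygonal curve `P` in `ℝ³`: the least genus of a
compact connected orientable PL surface embedded in `ℝ³` whose boundary is (a subdivision of) an
embedded closed polygonal curve `Q` ambient isotopic to `P`. -/
noncomputable def knotGenus {n : ℕ} (P : Polygon (EuclideanSpace ℝ (Fin 3)) n) : ℝ :=
  sInf {g : ℝ | ∃ (m : ℕ) (Q : Polygon (EuclideanSpace ℝ (Fin 3)) m)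
    (S : Geometry.SimplicialComplex ℝ (EuclideanSpace ℝ (Fin 3))),
    IsEmbeddedPolygon Q ∧ AmbientIsotopic (P.boundary ℝ) (Q.boundary ℝ) ∧
    IsPLSurface S ∧ IsConnected S.space ∧ (∃ o, IsOrientation S o) ∧
    IsSubdivisionOf (boundaryComplex S) Q ∧ g = surfaceGenus S}

/-! Let `C` be the component of `S` containing the connected curve $P$. It is a connected oriented
surface with the same boundary and at most as many triangles, so it competes in the infimum defining
`knotGenus P`, and it suffices to bound its own genus $g$.

Let $V, E, t, b$ count the vertices, edges, triangles and boundary edges of `C`. Double counting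
gives $3t + b = 2E$, and one boundary component gives $\chi = 1 - 2g$; hence $4g + 1 = t + b - 2V +
3$. Every vertex lies on at most two boundary edges, because its link is connected with degrees 1
and 2, so $b \le V$. With $V \ge 3$ this yields $4g + 1 \le t$
(`IsPLSurface.four_mul_surfaceGenus_add_one_le`).

The infimum is taken in ℝ, so comparison with a member requires a lower bound: $g \ge 0$ for every
competitor. This is $\chi \le 1$, proved with mod 2 homology: $H_2 = 0$ as the boundary is nonempty,
and $H_0$ has dimension at most 1 (`IsPLSurface.eulerChar_le_one`). -/

open Geometry

/-! ### Combinatorial components of a surface -/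

section Connectivity

variable {E : Type*} [AddCommGroup E] [Module ℝ E]

open scoped Classical in
/-- The `1`-skeleton of `S`, as a graph on the ambient space. -/
def edgeGraph (S : SimplicialComplex ℝ E) : SimpleGraph E where
  Adj x y := x ≠ y ∧ ({x, y} : Finset E) ∈ S.faces
  symm := ⟨by
    rintro x y ⟨h, h'⟩
    refine ⟨h.symm, ?_⟩
    rwa [Finset.pair_comm]⟩
  loopless := ⟨fun _ h => h.1 rfl⟩

theorem reachable_of_mem_face {S : SimplicialComplex ℝ E} {s : Finset E} (hs : s ∈ S.faces)
    {x y : E} (hx : x ∈ s) (hy : y ∈ s) : (edgeGraph S).Reachable x y := by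
  classical
  by_cases h : x = y
  · rw [h]
  · refine SimpleGraph.Adj.reachable ⟨h, S.down_closed hs ?_ (by simp)⟩
    simp [Finset.insert_subset_iff, hx, hy]

/-- The subcomplex of `S` formed by the faces whose vertices are joined to `v` by edge paths. -/
def componentComplex (S : SimplicialComplex ℝ E) (v : E) : SimplicialComplex ℝ E where
  faces := {s | s ∈ S.faces ∧ ∀ x ∈ s, (edgeGraph S).Reachable v x}
  isRelLowerSet_faces := by
    rintro s ⟨hs, h⟩
    exact ⟨S.nonempty_of_mem_faces hs,
      fun t hts ht => ⟨S.down_closed hs hts ht, fun x hx => h x (hts hx)⟩⟩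
  indep hs := S.indep hs.1
  inter_subset_convexHull hs ht := S.inter_subset_convexHull hs.1 ht.1

theorem componentComplex_faces_subset (S : SimplicialComplex ℝ E) (v : E) :
    (componentComplex S v).faces ⊆ S.faces := fun _ h => h.1

theorem mem_componentComplex_of_mem {S : SimplicialComplex ℝ E} {v x : E} {s : Finset E}
    (hs : s ∈ S.faces) (hx : x ∈ s) (hvx : (edgeGraph S).Reachable v x) :
    s ∈ (componentComplex S v).faces :=
  ⟨hs, fun _ hy => hvx.trans (reachable_of_mem_face hs hx hy)⟩

theorem mem_componentComplex_of_superset {S : SimplicialComplex ℝ E} {v : E} {s t : Finset E}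
    (hs : s ∈ (componentComplex S v).faces) (ht : t ∈ S.faces) (hst : s ⊆ t) :
    t ∈ (componentComplex S v).faces := by
  obtain ⟨x, hx⟩ := S.nonempty_of_mem_faces hs.1
  exact mem_componentComplex_of_mem ht (hst hx) (hs.2 x hx)

theorem triangleDegree_componentComplex {S : SimplicialComplex ℝ E} {v : E} {e : Finset E}
    (he : e ∈ (componentComplex S v).faces) :
    triangleDegree (componentComplex S v) e = triangleDegree S e := by
  unfold triangleDegree
  congr 1
  ext s
  exact ⟨fun h => ⟨h.1.1, h.2⟩, fun h => ⟨mem_componentComplex_of_superset he h.1 h.2.2, h.2⟩⟩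

/-- Every face of `S` through `x` lies in the component, so passing to it leaves the link unchanged.
-/
theorem linkGraph_componentComplex_connected {S : SimplicialComplex ℝ E} {v x : E}
    (hx : x ∈ (componentComplex S v).vertices) (h : (linkGraph S x).Connected) :
    (linkGraph (componentComplex S v) x).Connected := by
  classical
  have hx' : (edgeGraph S).Reachable v x := hx.2 x (by simp)
  let f : linkGraph S x →g linkGraph (componentComplex S v) x :=
    { toFun := fun w => ⟨w.1, w.2.1, mem_componentComplex_of_mem w.2.2 (by simp) hx'⟩
      map_rel' := by
        rintro a b ⟨hab, hf⟩
        refine ⟨fun h => hab (Subtype.ext (by simpa using h)), ?_⟩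
        exact mem_componentComplex_of_mem hf (by simp) hx' }
  exact h.map f fun w => ⟨⟨w.1, w.2.1, w.2.2.1⟩, rfl⟩

theorem IsPLSurface.componentComplex {S : SimplicialComplex ℝ E} (hS : IsPLSurface S) (v : E) :
    IsPLSurface (componentComplex S v) where
  finite := hS.finite.subset (componentComplex_faces_subset S v)
  card_le s hs := hS.card_le s hs.1
  pure s hs := by
    obtain ⟨t, ht, hc, hst⟩ := hS.pure s hs.1
    exact ⟨t, mem_componentComplex_of_superset hs ht hst, hc, hst⟩
  edge e he hc := by
    rw [triangleDegree_componentComplex he]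
    exact hS.edge e he.1 hc
  link x hx := linkGraph_componentComplex_connected hx (hS.link x hx.1)

theorem IsOrientation.componentComplex {S : SimplicialComplex ℝ E}
    {o : Finset E → Equiv.Perm E} (ho : IsOrientation S o) (v : E) :
    IsOrientation (componentComplex S v) o where
  isCycle s hs := ho.isCycle s hs.1
  support s hs := ho.support s hs.1
  coherent s hs t ht := ho.coherent s hs.1 t ht.1

theorem boundaryComplex_componentComplex {S : SimplicialComplex ℝ E} {v : E}
    (h : ∀ x ∈ (boundaryComplex S).vertices, (edgeGraph S).Reachable v x) :
    boundaryComplex (componentComplex S v) = boundaryComplex S := by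
  ext s
  constructor
  · rintro ⟨hs, e, he, hc, hd, hse⟩
    exact ⟨hs, e, he.1, hc, by rwa [triangleDegree_componentComplex he] at hd, hse⟩
  · rintro ⟨hs, e, he, hc, hd, hse⟩
    have he' : e ∈ (_root_.componentComplex S v).faces :=
      ⟨he, fun x hx => h x ⟨by simp, e, he, hc, hd, by simpa using hx⟩⟩
    exact ⟨hs, e, he', hc, by rwa [triangleDegree_componentComplex he'], hse⟩

end Connectivity

/-! ### Edge paths versus topological connectedness -/

section Topology

variable {E : Type*} [NormedAddCommGroup E] [NormedSpace ℝ E]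

/-- The faces reachable from `x` and the others have finite, hence closed, unions covering `A`. If
`y` were unreachable, these unions would meet, and faces that meet share a vertex. -/
theorem reachable_of_isPreconnected {S : SimplicialComplex ℝ E} (hfin : S.faces.Finite)
    {A : Set E} (hA : IsPreconnected A) (hAS : A ⊆ S.space) {x y : E}
    (hx : x ∈ S.vertices) (hxA : x ∈ A) (hy : y ∈ S.vertices) (hyA : y ∈ A) :
    (edgeGraph S).Reachable x y := by
  by_contra hxy
  let F : Set (Finset E) := {s | s ∈ S.faces ∧ ∀ z ∈ s, (edgeGraph S).Reachable x z}
  let G : Set (Finset E) := {s | s ∈ S.faces ∧ ∀ z ∈ s, ¬ (edgeGraph S).Reachable x z}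
  have hclosed : ∀ H : Set (Finset E), H ⊆ S.faces →
      IsClosed (⋃ s ∈ H, convexHull ℝ (s : Set E)) := fun H hH =>
    (hfin.subset hH).isClosed_biUnion fun s _ => (s.finite_toSet.isCompact_convexHull ℝ).isClosed
  have hcover : A ⊆ (⋃ s ∈ F, convexHull ℝ (s : Set E)) ∪ ⋃ s ∈ G, convexHull ℝ (s : Set E) := by
    intro z hz
    obtain ⟨s, hs, hzs⟩ := SimplicialComplex.mem_space_iff.1 (hAS hz)
    obtain ⟨w, hw⟩ := S.nonempty_of_mem_faces hs
    by_cases h : (edgeGraph S).Reachable x w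
    · exact Or.inl (Set.mem_biUnion
        (show s ∈ F from ⟨hs, fun u hu => h.trans (reachable_of_mem_face hs hw hu)⟩) hzs)
    · exact Or.inr (Set.mem_biUnion
        (show s ∈ G from ⟨hs, fun u hu hu' => h (hu'.trans (reachable_of_mem_face hs hu hw))⟩) hzs)
  obtain ⟨z, -, hzF, hzG⟩ := isPreconnected_closed_iff.1 hA _ _ (hclosed F fun _ h => h.1)
    (hclosed G fun _ h => h.1) hcover
    ⟨x, hxA, Set.mem_biUnion (show {x} ∈ F from ⟨hx, by simp⟩) (by simp)⟩
    ⟨y, hyA, Set.mem_biUnion (show {y} ∈ G from ⟨hy, by simpa using hxy⟩) (by simp)⟩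
  obtain ⟨s, hs, hzs⟩ := Set.mem_iUnion₂.1 hzF
  obtain ⟨t, ht, hzt⟩ := Set.mem_iUnion₂.1 hzG
  obtain ⟨w, hws, hwt⟩ := convexHull_nonempty_iff.1
    ⟨z, S.inter_subset_convexHull hs.1 ht.1 ⟨hzs, hzt⟩⟩
  exact ht.2 w hwt (hs.2 w hws)

theorem isConnected_space_componentComplex {S : SimplicialComplex ℝ E} {v : E}
    (hv : v ∈ S.vertices) : IsConnected (componentComplex S v).space := by
  set C := componentComplex S v with hC
  have hvertex : ∀ x, (edgeGraph S).Reachable v x → JoinedIn C.space v x := by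
    intro x hx
    rw [SimpleGraph.reachable_iff_reflTransGen] at hx
    induction hx with
    | refl => exact JoinedIn.refl (SimplicialComplex.vertices_subset_space
        (show {v} ∈ C.faces from ⟨hv, by simp⟩))
    | @tail b c hb hbc ih =>
      classical
      refine ih.trans (JoinedIn.of_segment_subset ?_)
      have hf : ({b, c} : Finset E) ∈ C.faces :=
        mem_componentComplex_of_mem hbc.2 (by simp)
          ((SimpleGraph.reachable_iff_reflTransGen _ _).2 hb)
      refine subset_trans ?_ (C.convexHull_subset_space hf)
      simp [convexHull_pair]
  refine IsPathConnected.isConnected ⟨v, (hvertex v .rfl).source_mem, fun {y} hy => ?_⟩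
  obtain ⟨s, hs, hys⟩ := SimplicialComplex.mem_space_iff.1 hy
  obtain ⟨x, hx⟩ := S.nonempty_of_mem_faces hs.1
  refine (hvertex x (hs.2 x hx)).trans (JoinedIn.of_segment_subset ?_)
  exact ((convex_convexHull ℝ _).segment_subset (subset_convexHull ℝ _ hx) hys).trans
    (C.convexHull_subset_space hs)

theorem Polygon.isConnected_boundary {n : ℕ} (P : Polygon E (n + 1)) :
    IsConnected (P.boundary ℝ) := by
  have hseg : ∀ i, segment ℝ (P i) (P (finRotate _ i)) ⊆ P.boundary ℝ := fun i => by
    rw [← affineSegment_eq_segment]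
    exact Set.subset_iUnion (fun i => P.edgeSet ℝ i) i
  have hvertex : ∀ i, JoinedIn (P.boundary ℝ) (P 0) (P i) := by
    intro i
    induction i using Fin.induction with
    | zero => exact JoinedIn.refl (hseg 0 (left_mem_segment ℝ _ _))
    | succ i ih =>
      refine ih.trans (JoinedIn.of_segment_subset ?_)
      simpa using hseg i.castSucc
  refine IsPathConnected.isConnected ⟨P 0, (hvertex 0).source_mem, fun {y} hy => ?_⟩
  obtain ⟨i, hi⟩ := Set.mem_iUnion.1 hy
  refine (hvertex i).trans (JoinedIn.of_segment_subset (subset_trans ?_ (hseg i)))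
  refine (convex_segment _ _).segment_subset (left_mem_segment ℝ _ _) ?_
  rwa [← affineSegment_eq_segment]

theorem IsEmbeddedPolygon.isConnected_boundary {n : ℕ} {P : Polygon E n}
    (hP : IsEmbeddedPolygon P) : IsConnected (P.boundary ℝ) := by
  obtain ⟨m, rfl⟩ : ∃ m, n = m + 1 := ⟨n - 1, by have := hP.three_le; omega⟩
  exact P.isConnected_boundary

theorem boundaryComponents_eq_one {S : SimplicialComplex ℝ E}
    (h : IsConnected (boundaryComplex S).space) : boundaryComponents S = 1 := by
  have : ConnectedSpace (boundaryComplex S).space := isConnected_iff_connectedSpace.1 h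
  have : Nonempty (ConnectedComponents (boundaryComplex S).space) :=
    Nonempty.map ConnectedComponents.mk inferInstance
  exact Nat.card_eq_one_iff_unique.2 ⟨inferInstance, this⟩

theorem AmbientIsotopic.refl {X : Type*} [TopologicalSpace X] (A : Set X) :
    AmbientIsotopic A A :=
  ⟨fun _ => Homeomorph.refl X, continuous_snd, fun _ => rfl, by simp⟩

end Topology

/-- The degree sum is $2|W|$ minus the number of leaves, while connectedness forces at least $|W| -
1$ edges. This is applied to vertex links. -/
theorem SimpleGraph.Connected.ncard_leaves_le_two {W : Type*} [Finite W] {G : SimpleGraph W}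
    (hG : G.Connected) (hdeg : ∀ w, (G.neighborSet w).ncard = 1 ∨ (G.neighborSet w).ncard = 2) :
    {w | (G.neighborSet w).ncard = 1}.ncard ≤ 2 := by
  classical
  have := Fintype.ofFinite W
  have hd : ∀ w, (G.neighborSet w).ncard = G.degree w := fun w => by
    rw [Set.ncard_eq_toFinset_card', ← SimpleGraph.card_neighborFinset_eq_degree,
      SimpleGraph.neighborFinset]
  simp only [hd] at hdeg ⊢
  have h1 := hG.card_vert_le_card_edgeSet_add_one
  rw [Nat.card_eq_fintype_card, Nat.card_eq_fintype_card, ← SimpleGraph.edgeFinset_card] at h1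
  have h2 := G.sum_degrees_eq_twice_card_edges
  have h3 : ∑ w, (G.degree w + if G.degree w = 1 then 1 else 0) = ∑ _w : W, 2 :=
    Finset.sum_congr rfl fun w _ => by rcases hdeg w with h | h <;> simp [h]
  rw [Finset.sum_add_distrib, h2, ← Finset.card_filter] at h3
  simp only [Finset.sum_const, Finset.card_univ, smul_eq_mul] at h3
  rw [Set.ncard_eq_toFinset_card', Set.toFinset_ofPred]
  omega

/-! ### Incidence counts on a surface -/

section Counting

variable {E : Type*} [AddCommGroup E] [Module ℝ E] {S : SimplicialComplex ℝ E}

theorem faceCount_zero (S : SimplicialComplex ℝ E) : faceCount S 0 = S.vertices.ncard := by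
  have : {s | s ∈ S.faces ∧ s.card = 0 + 1} = (fun x : E => ({x} : Finset E)) '' S.vertices := by
    ext s
    constructor
    · rintro ⟨hs, hc⟩
      obtain ⟨x, rfl⟩ := Finset.card_eq_one.1 hc
      exact ⟨x, hs, rfl⟩
    · rintro ⟨x, hx, rfl⟩
      exact ⟨hx, by simp⟩
  rw [faceCount, this, Set.ncard_image_of_injective _ Finset.singleton_injective]

theorem IsPLSurface.finite_vertices (hS : IsPLSurface S) : S.vertices.Finite :=
  hS.finite.preimage Finset.singleton_injective.injOn

theorem mem_vertices_of_mem {s : Finset E} (hs : s ∈ S.faces) {x : E} (hx : x ∈ s) :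
    x ∈ S.vertices :=
  S.down_closed hs (by simpa using hx) (by simp)

/-- The number of boundary edges of a surface. -/
noncomputable def boundaryEdgeCount (S : SimplicialComplex ℝ E) : ℕ :=
  {e | e ∈ S.faces ∧ e.card = 2 ∧ triangleDegree S e = 1}.ncard

theorem IsPLSurface.three_mul_triangleCount_add (hS : IsPLSurface S) :
    3 * triangleCount S + boundaryEdgeCount S = 2 * faceCount S 1 := by
  classical
  set D := hS.finite.toFinset.filter (fun e => e.card = 2) with hD
  set T := hS.finite.toFinset.filter (fun t => t.card = 3) with hT
  have hmD : ∀ e, e ∈ D ↔ e ∈ S.faces ∧ e.card = 2 := by simp [hD]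
  have hmT : ∀ e, e ∈ T ↔ e ∈ S.faces ∧ e.card = 3 := by simp [hT]
  have hF : triangleCount S = T.card := by
    rw [triangleCount, faceCount, ← Set.ncard_coe_finset]
    congr 1; ext; simp [hmT]
  have hE : faceCount S 1 = D.card := by
    rw [faceCount, ← Set.ncard_coe_finset]
    congr 1; ext; simp [hmD]
  have hB : boundaryEdgeCount S = (D.filter fun e => triangleDegree S e = 1).card := by
    rw [boundaryEdgeCount, ← Set.ncard_coe_finset]
    congr 1; ext; simp [hmD, and_assoc]
  have hdeg : ∀ e, triangleDegree S e = (T.bipartiteAbove (· ⊆ ·) e).card := fun e => by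
    rw [triangleDegree, ← Set.ncard_coe_finset]
    congr 1; ext; simp [hmT, and_assoc]
  have hthree : ∀ t ∈ T, (D.bipartiteBelow (· ⊆ ·) t).card = 3 := fun t ht => by
    have : D.bipartiteBelow (· ⊆ ·) t = t.powersetCard 2 := by
      ext e
      simp only [Finset.mem_bipartiteBelow, hmD, Finset.mem_powersetCard]
      constructor
      · tauto
      · rintro ⟨h, hc⟩
        exact ⟨⟨S.down_closed ((hmT t).1 ht).1 h (Finset.card_pos.1 (by omega)), hc⟩, h⟩
    rw [this, Finset.card_powersetCard, ((hmT t).1 ht).2]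
    rfl
  have hcount := Finset.sum_card_bipartiteAbove_eq_sum_card_bipartiteBelow
    (s := D) (t := T) (fun e t : Finset E => e ⊆ t)
  rw [Finset.sum_congr rfl hthree, Finset.sum_const, smul_eq_mul] at hcount
  -- Adding 1 at each boundary edge makes every edge count exactly 2.
  have htwo : ∑ e ∈ D, ((T.bipartiteAbove (· ⊆ ·) e).card +
      if triangleDegree S e = 1 then 1 else 0) = ∑ _e ∈ D, 2 := by
    refine Finset.sum_congr rfl fun e he => ?_
    rw [← hdeg]
    rcases hS.edge e ((hmD e).1 he).1 ((hmD e).1 he).2 with h | h <;> simp [h]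
  rw [Finset.sum_add_distrib, hcount, ← Finset.card_filter, ← hB, Finset.sum_const,
    smul_eq_mul, ← hE, ← hF] at htwo
  omega

open scoped Classical in
theorem ncard_neighborSet_linkGraph (S : SimplicialComplex ℝ E) (v : E)
    (w : {w : E // w ≠ v ∧ ({v, w} : Finset E) ∈ S.faces}) :
    ((linkGraph S v).neighborSet w).ncard = triangleDegree S {v, w.1} := by
  unfold triangleDegree
  refine Set.ncard_congr (fun w' _ => {v, w.1, w'.1}) ?_ ?_ ?_
  · rintro w' ⟨hne, hf⟩
    have hne' : w.1 ≠ w'.1 := fun h => hne (Subtype.ext h)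
    exact ⟨hf, Finset.card_eq_three.2 ⟨v, w, w', w.2.1.symm, w'.2.1.symm, hne', rfl⟩, by grind⟩
  · rintro a b ⟨ha, -⟩ ⟨hb, -⟩ hab
    have h1 : w.1 ≠ a.1 := fun h => ha (Subtype.ext h)
    have h2 : a.1 ∈ ({v, w.1, b.1} : Finset E) := hab ▸ by simp
    have h3 := a.2.1
    ext
    grind
  · rintro s ⟨hs, hc, hsub⟩
    have hcard : ({v, w.1} : Finset E).card = 2 := Finset.card_pair w.2.1.symm
    obtain ⟨x, hx, hx'⟩ := Finset.exists_mem_notMem_of_card_lt_card (s := {v, w.1}) (t := s)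
      (by omega)
    simp only [Finset.mem_insert, Finset.mem_singleton, not_or] at hx'
    have hvs : v ∈ s := hsub (by simp)
    have hws : w.1 ∈ s := hsub (by simp)
    have heq : ({v, w.1, x} : Finset E) = s := by
      refine Finset.eq_of_subset_of_card_le (by grind) ?_
      rw [hc, Finset.card_eq_three.2 ⟨v, w, x, w.2.1.symm, Ne.symm hx'.1, Ne.symm hx'.2, rfl⟩]
    refine ⟨⟨x, hx'.1, S.down_closed hs (by grind) (by simp)⟩, ⟨?_, ?_⟩, heq⟩
    · exact fun h => hx'.2 (congrArg Subtype.val h).symm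
    · exact heq ▸ hs

/-- Boundary edges at `v` correspond to leaves of the link of `v`. -/
theorem IsPLSurface.ncard_boundary_edges_at_le_two (hS : IsPLSurface S) {v : E}
    (hv : v ∈ S.vertices) :
    {e | e ∈ S.faces ∧ e.card = 2 ∧ triangleDegree S e = 1 ∧ v ∈ e}.ncard ≤ 2 := by
  classical
  have : Finite {w : E // w ≠ v ∧ ({v, w} : Finset E) ∈ S.faces} := by
    refine (hS.finite_vertices.subset ?_).to_subtype
    exact fun w hw => mem_vertices_of_mem hw.2 (by simp)
  have hlink := (hS.link v hv).ncard_leaves_le_two fun w => by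
    rw [ncard_neighborSet_linkGraph]
    exact hS.edge _ w.2.2 (Finset.card_pair w.2.1.symm)
  simp only [ncard_neighborSet_linkGraph] at hlink
  refine le_trans (le_trans (Set.ncard_le_ncard ?_ (Set.toFinite _)) (Set.ncard_image_le
    (f := fun w : {w : E // w ≠ v ∧ ({v, w} : Finset E) ∈ S.faces} => ({v, w.1} : Finset E))
    (Set.toFinite _))) hlink
  rintro e ⟨he, hc, hd, hve⟩
  obtain ⟨w, hw⟩ := Finset.card_eq_one.1 (show (e.erase v).card = 1 by
    rw [Finset.card_erase_of_mem hve, hc])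
  have heq : {v, w} = e := by rw [← Finset.insert_erase hve, hw]
  have hwv : w ≠ v := fun h => by subst h; simp [← heq] at hc
  exact ⟨⟨w, hwv, heq ▸ he⟩, by simpa [heq] using hd, heq⟩

/-- Count incidences of vertices with boundary edges: at most two per vertex, exactly two per edge.
-/
theorem IsPLSurface.boundaryEdgeCount_le (hS : IsPLSurface S) :
    boundaryEdgeCount S ≤ faceCount S 0 := by
  classical
  set B := hS.finite.toFinset.filter (fun e => e.card = 2 ∧ triangleDegree S e = 1) with hB
  set V := hS.finite_vertices.toFinset with hV
  have hmB : ∀ e, e ∈ B ↔ e ∈ S.faces ∧ e.card = 2 ∧ triangleDegree S e = 1 := by simp [hB]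
  have hBc : boundaryEdgeCount S = B.card := by
    rw [boundaryEdgeCount, ← Set.ncard_coe_finset]
    congr 1; ext e; exact (hmB e).symm
  have hVc : faceCount S 0 = V.card := by
    rw [faceCount_zero, Set.ncard_eq_toFinset_card _ hS.finite_vertices]
  have hcount := Finset.sum_card_bipartiteAbove_eq_sum_card_bipartiteBelow
    (s := V) (t := B) (fun (v : E) (e : Finset E) => v ∈ e)
  have h1 : ∑ v ∈ V, (B.bipartiteAbove (fun (v : E) (e : Finset E) => v ∈ e) v).card ≤
      ∑ _v ∈ V, 2 := by
    refine Finset.sum_le_sum fun v hv => ?_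
    refine le_of_eq_of_le ?_ (hS.ncard_boundary_edges_at_le_two (by simpa [hV] using hv))
    rw [← Set.ncard_coe_finset]
    congr 1; ext; simp [hmB, and_assoc]
  have h2 : ∑ e ∈ B, (V.bipartiteBelow (fun (v : E) (e : Finset E) => v ∈ e) e).card =
      ∑ _e ∈ B, 2 := by
    refine Finset.sum_congr rfl fun e he => ?_
    rw [← ((hmB e).1 he).2.1]
    congr 1
    ext x
    simp only [Finset.mem_bipartiteBelow, hV, Set.Finite.mem_toFinset, and_iff_right_iff_imp]
    exact mem_vertices_of_mem ((hmB e).1 he).1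
  rw [hcount, h2, Finset.sum_const, Finset.sum_const, smul_eq_mul, smul_eq_mul] at h1
  omega

theorem IsPLSurface.three_le_faceCount_zero (hS : IsPLSurface S) (hne : S.faces.Nonempty) :
    3 ≤ faceCount S 0 := by
  obtain ⟨s, hs⟩ := hne
  obtain ⟨t, ht, hc, -⟩ := hS.pure s hs
  rw [faceCount_zero, ← hc, ← Set.ncard_coe_finset]
  exact Set.ncard_le_ncard (fun x hx => mem_vertices_of_mem ht hx) hS.finite_vertices

end Counting

/-! ### Mod 2 homology and the bound on the Euler characteristic -/

section Homology

variable {E : Type*} [AddCommGroup E] [Module ℝ E] {S : SimplicialComplex ℝ E}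

theorem ncard_edges_between_vertex_triangle {t : Finset E} (ht : t ∈ S.faces) (hc : t.card = 3)
    {x : E} (hx : x ∈ t) : {e | e ∈ S.faces ∧ e.card = 2 ∧ x ∈ e ∧ e ⊆ t}.ncard = 2 := by
  classical
  have hcard : (t.erase x).card = 2 := by rw [Finset.card_erase_of_mem hx, hc]
  rw [← Set.ncard_coe_finset] at hcard
  refine Eq.trans (Eq.symm ?_) hcard
  refine Set.ncard_congr (fun y _ => {x, y}) ?_ ?_ ?_
  · intro y hy
    have hy' := Finset.mem_erase.1 hy
    have hsub : {x, y} ⊆ t := by grind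
    exact ⟨S.down_closed ht hsub (by simp), Finset.card_pair hy'.1.symm, by simp, hsub⟩
  · intro a b ha hb hab
    have ha' := Finset.mem_erase.1 ha
    have : a ∈ ({x, b} : Finset E) := hab ▸ by simp
    grind
  · rintro e ⟨-, hec, hxe, het⟩
    obtain ⟨w, hw⟩ := Finset.card_eq_one.1 (show (e.erase x).card = 1 by
      rw [Finset.card_erase_of_mem hxe, hec])
    refine ⟨w, ?_, by rw [← Finset.insert_erase hxe, hw]⟩
    have : w ∈ e.erase x := by simp [hw]
    grind

/-- A function on the triangles of a connected surface is constant as soon as it takes the same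
value on any two triangles with a common edge. -/
theorem IsPLSurface.eq_of_eq_on_adjacent (hS : IsPLSurface S)
    (hconn : ∀ x ∈ S.vertices, ∀ y ∈ S.vertices, (edgeGraph S).Reachable x y)
    {α : Type*} {c : Finset E → α}
    (hc : ∀ e ∈ S.faces, e.card = 2 → ∀ s ∈ S.faces, ∀ t ∈ S.faces, s.card = 3 → t.card = 3 →
      e ⊆ s → e ⊆ t → c s = c t)
    {s t : Finset E} (hs : s ∈ S.faces) (ht : t ∈ S.faces) (hsc : s.card = 3) (htc : t.card = 3) :
    c s = c t := by
  classical
  -- Two triangles at `v` are connected by a path in the link of `v`, whose consecutive triangles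
  -- share an edge through `v`.
  have hlocal : ∀ v, ∀ s ∈ S.faces, ∀ t ∈ S.faces, s.card = 3 → t.card = 3 → v ∈ s → v ∈ t →
      c s = c t := by
    intro v
    have key : ∀ w w', (linkGraph S v).Reachable w w' → ∀ s ∈ S.faces, ∀ t ∈ S.faces,
        s.card = 3 → t.card = 3 → {v, w.1} ⊆ s → {v, w'.1} ⊆ t → c s = c t := by
      intro w w' h
      rw [SimpleGraph.reachable_iff_reflTransGen] at h
      induction h with
      | refl =>
        exact fun s hs t ht hsc htc h1 h2 =>
          hc _ w.2.2 (Finset.card_pair w.2.1.symm) s hs t ht hsc htc h1 h2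
      | @tail a b _ hab ih =>
        intro s hs t ht hsc htc h1 h2
        have hne : a.1 ≠ b.1 := fun h => hab.1 (Subtype.ext h)
        have h3 : ({v, a.1, b.1} : Finset E).card = 3 :=
          Finset.card_eq_three.2 ⟨v, a, b, a.2.1.symm, b.2.1.symm, hne, rfl⟩
        rw [ih s hs _ hab.2 hsc h3 h1 (by grind)]
        exact hc _ b.2.2 (Finset.card_pair b.2.1.symm) _ hab.2 t ht h3 htc (by grind) h2
    intro s hs t ht hsc htc hvs hvt
    have hother : ∀ u ∈ S.faces, u.card = 3 → v ∈ u →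
        ∃ w : {w : E // w ≠ v ∧ ({v, w} : Finset E) ∈ S.faces}, {v, w.1} ⊆ u := by
      intro u hu huc hvu
      obtain ⟨w, hw, hwv⟩ := Finset.exists_mem_ne (by omega : 1 < u.card) v
      have hsub : {v, w} ⊆ u := by grind
      exact ⟨⟨w, hwv, S.down_closed hu hsub (by simp)⟩, hsub⟩
    obtain ⟨w, hw⟩ := hother s hs hsc hvs
    obtain ⟨w', hw'⟩ := hother t ht htc hvt
    exact key w w' ((hS.link v (mem_vertices_of_mem hs hvs)).preconnected w w') s hs t ht hsc htc
      hw hw'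
  -- Along an edge path, purity supplies a triangle on each edge, through which the value passes
  -- from one endpoint to the next.
  have key : ∀ x y, (edgeGraph S).Reachable x y → ∀ s ∈ S.faces, ∀ t ∈ S.faces,
      s.card = 3 → t.card = 3 → x ∈ s → y ∈ t → c s = c t := by
    intro x y h
    rw [SimpleGraph.reachable_iff_reflTransGen] at h
    induction h with
    | refl => exact fun s hs t ht hsc htc => hlocal x s hs t ht hsc htc
    | @tail a b _ hab ih =>
      intro s hs t ht hsc htc h1 h2
      obtain ⟨u, hu, huc, hsub⟩ := hS.pure _ hab.2
      rw [ih s hs u hu hsc huc h1 (hsub (by simp))]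
      exact hlocal b u hu t ht huc htc (hsub (by simp)) h2
  obtain ⟨x, hx⟩ := S.nonempty_of_mem_faces hs
  obtain ⟨y, hy⟩ := S.nonempty_of_mem_faces ht
  exact key x y (hconn x (mem_vertices_of_mem hs hx) y (mem_vertices_of_mem ht hy)) s hs t ht
    hsc htc hx hy

open scoped Classical in
/-- The incidence matrix modulo two between edges and vertices. -/
noncomputable def edgeVertexMatrix (S : SimplicialComplex ℝ E) :
    Matrix {e // e ∈ S.faces ∧ e.card = 1 + 1} S.vertices (ZMod 2) :=
  fun e x => if x.1 ∈ e.1 then 1 else 0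

open scoped Classical in
/-- The incidence matrix modulo two between triangles and edges. -/
noncomputable def triangleEdgeMatrix (S : SimplicialComplex ℝ E) :
    Matrix {t // t ∈ S.faces ∧ t.card = 2 + 1} {e // e ∈ S.faces ∧ e.card = 1 + 1} (ZMod 2) :=
  fun t e => if e.1 ⊆ t.1 then 1 else 0

/-- This is $\partial\partial = 0$: a vertex of a triangle lies on two of its edges, and $2 = 0$. -/
theorem triangleEdgeMatrix_mul_edgeVertexMatrix
    [Fintype {e // e ∈ S.faces ∧ e.card = 1 + 1}] :
    triangleEdgeMatrix S * edgeVertexMatrix S = 0 := by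
  classical
  ext t x
  simp only [Matrix.mul_apply, triangleEdgeMatrix, edgeVertexMatrix, Matrix.zero_apply,
    ← ite_and, mul_ite, mul_one, mul_zero]
  rw [Finset.sum_boole]
  by_cases hx : x.1 ∈ t.1
  · have h := ncard_edges_between_vertex_triangle t.2.1 t.2.2 hx
    rw [← Set.ncard_coe_finset, ← Set.ncard_image_of_injective _ Subtype.val_injective]
    have hset : (Subtype.val '' (↑({e : {e // e ∈ S.faces ∧ e.card = 1 + 1} |
        x.1 ∈ e.1 ∧ e.1 ⊆ t.1} : Finset _) : Set {e // e ∈ S.faces ∧ e.card = 1 + 1})) =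
        {e | e ∈ S.faces ∧ e.card = 2 ∧ x.1 ∈ e ∧ e ⊆ t.1} := by
      ext e
      simp only [Set.mem_image, Finset.mem_coe, Finset.mem_filter_univ, Set.mem_ofPred_eq,
        Subtype.exists, exists_and_left, exists_prop, exists_eq_right_right]
      tauto
    rw [hset, h]
    rfl
  · rw [Finset.card_eq_zero.2]
    · simp
    · rw [Finset.filter_eq_empty_iff]
      exact fun e _ h => hx (h.2 h.1)

/-- A kernel vector takes equal values at the ends of each edge, so it is constant and evaluation at
one vertex embeds the kernel in `ZMod 2`. -/
theorem card_vertices_le_rank_edgeVertexMatrix [Fintype S.vertices]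
    (hconn : ∀ x ∈ S.vertices, ∀ y ∈ S.vertices, (edgeGraph S).Reachable x y) :
    Fintype.card S.vertices ≤ (edgeVertexMatrix S).rank + 1 := by
  classical
  have hker : ∀ f : S.vertices → ZMod 2, (edgeVertexMatrix S).mulVec f = 0 →
      ∀ x y, f x = f y := by
    intro f hf
    have key : ∀ x y, (edgeGraph S).Reachable x y → ∀ (hx : x ∈ S.vertices) (hy : y ∈ S.vertices),
        f ⟨x, hx⟩ = f ⟨y, hy⟩ := by
      intro x y h
      rw [SimpleGraph.reachable_iff_reflTransGen] at h
      induction h with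
      | refl => exact fun _ _ => rfl
      | @tail a b _ hab ih =>
        intro hx hb
        have ha : a ∈ S.vertices := mem_vertices_of_mem hab.2 (by simp)
        rw [ih hx ha]
        have h := congrFun hf ⟨{a, b}, hab.2, Finset.card_pair hab.1⟩
        simp only [Matrix.mulVec, dotProduct, edgeVertexMatrix, ite_mul, one_mul, zero_mul,
          Pi.zero_apply] at h
        rw [← Finset.sum_filter, show ({x | x.1 ∈ ({a, b} : Finset E)} : Finset S.vertices) =
          {⟨a, ha⟩, ⟨b, hb⟩} by ext x; simp [Subtype.ext_iff],
          Finset.sum_pair (fun h => hab.1 (congrArg Subtype.val h))] at h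
        exact CharTwo.add_eq_zero.1 h
    exact fun x y => key x y (hconn x x.2 y y.2) x.2 y.2
  rcases isEmpty_or_nonempty S.vertices with hV | ⟨⟨x₀⟩⟩
  · simp
  let ev : LinearMap.ker (edgeVertexMatrix S).mulVecLin →ₗ[ZMod 2] ZMod 2 :=
    (LinearMap.proj x₀).comp (Submodule.subtype _)
  have hev : Function.Injective ev := by
    rw [← LinearMap.ker_eq_bot, LinearMap.ker_eq_bot']
    intro f hf
    ext x
    rw [hker f.1 (LinearMap.mem_ker.1 f.2) x x₀]
    exact hf
  have hfin := LinearMap.finrank_le_finrank_of_injective hev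
  rw [Module.finrank_self] at hfin
  have h := LinearMap.finrank_range_add_finrank_ker (edgeVertexMatrix S).mulVecLin
  rw [Module.finrank_fintype_fun_eq_card] at h
  rw [Matrix.rank]
  omega

/-- A relation between the rows is a mod 2 two-cycle. Its coefficients agree on adjacent triangles,
hence everywhere, and vanish on the only triangle at a boundary edge. -/
theorem IsPLSurface.rank_triangleEdgeMatrix (hS : IsPLSurface S)
    (hconn : ∀ x ∈ S.vertices, ∀ y ∈ S.vertices, (edgeGraph S).Reachable x y)
    (hbd : (boundaryComplex S).faces.Nonempty)
    [Fintype {e // e ∈ S.faces ∧ e.card = 1 + 1}] [Fintype {t // t ∈ S.faces ∧ t.card = 2 + 1}] :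
    (triangleEdgeMatrix S).rank = Fintype.card {t // t ∈ S.faces ∧ t.card = 2 + 1} := by
  classical
  refine LinearIndependent.rank_matrix (Fintype.linearIndependent_iff.2 fun g hg => ?_)
  let c : Finset E → ZMod 2 := fun s => if h : s ∈ S.faces ∧ s.card = 2 + 1 then g ⟨s, h⟩ else 0
  have hcg : ∀ t, g t = c t.1 := fun t => by
    simp only [c]
    rw [dif_pos t.2]
  let N : Finset E → Finset {t // t ∈ S.faces ∧ t.card = 2 + 1} := fun e => {t | e ⊆ t.1}
  have hmN : ∀ e t, t ∈ N e ↔ e ⊆ t.1 := by simp [N]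
  have hN : ∀ e, (N e).card = triangleDegree S e := fun e => by
    rw [triangleDegree, ← Set.ncard_coe_finset,
      ← Set.ncard_image_of_injective _ Subtype.val_injective]
    congr 1
    ext t
    simp only [Set.mem_image, Finset.mem_coe, hmN, Set.mem_ofPred_eq, Subtype.exists,
      exists_and_left, exists_prop, exists_eq_right_right]
    tauto
  have hsum : ∀ e ∈ S.faces, e.card = 2 → ∑ t ∈ N e, g t = 0 := by
    intro e he hec
    have h := congrFun hg ⟨e, he, hec⟩
    simpa [triangleEdgeMatrix, Finset.sum_apply, N, Finset.sum_filter] using h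
  have hadj : ∀ e ∈ S.faces, e.card = 2 → ∀ s ∈ S.faces, ∀ t ∈ S.faces, s.card = 3 →
      t.card = 3 → e ⊆ s → e ⊆ t → c s = c t := by
    intro e he hec s hs t ht hsc htc hes het
    by_cases hst : s = t
    · rw [hst]
    have hne : (⟨s, hs, hsc⟩ : {t // t ∈ S.faces ∧ t.card = 2 + 1}) ≠ ⟨t, ht, htc⟩ :=
      fun h => hst (congrArg Subtype.val h)
    have hpair : {⟨s, hs, hsc⟩, ⟨t, ht, htc⟩} = N e := by
      refine Finset.eq_of_subset_of_card_le ?_ ?_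
      · simp [Finset.insert_subset_iff, hmN, hes, het]
      · rw [Finset.card_pair hne, hN]
        rcases hS.edge e he hec with h | h <;> omega
    have h := hsum e he hec
    rw [← hpair, Finset.sum_pair hne, hcg, hcg] at h
    exact CharTwo.add_eq_zero.1 h
  obtain ⟨_, _, e, he, hec, hed, _⟩ := hbd
  obtain ⟨t₀, ht₀⟩ := Finset.card_eq_one.1 ((hN e).trans hed)
  have h₀ : c t₀.1 = 0 := by
    have h := hsum e he hec
    rwa [ht₀, Finset.sum_singleton, hcg] at h
  intro t
  rw [hcg, ← h₀]
  exact hS.eq_of_eq_on_adjacent hconn hadj t.2.1 t₀.2.1 t.2.2 t₀.2.2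

/-- A connected surface with nonempty boundary has Euler characteristic at most one. -/
theorem IsPLSurface.eulerChar_le_one (hS : IsPLSurface S)
    (hconn : ∀ x ∈ S.vertices, ∀ y ∈ S.vertices, (edgeGraph S).Reachable x y)
    (hbd : (boundaryComplex S).faces.Nonempty) : eulerChar S ≤ 1 := by
  have : Fintype S.vertices := hS.finite_vertices.fintype
  have hface : ∀ k, Finite {s // s ∈ S.faces ∧ s.card = k + 1} := fun k =>
    (hS.finite.subset fun _ h => h.1 : {s | s ∈ S.faces ∧ s.card = k + 1}.Finite).to_subtype
  have hcount : ∀ k, Nat.card {s // s ∈ S.faces ∧ s.card = k + 1} = faceCount S k := fun k =>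
    Nat.card_coe_set_eq _
  have := hface 1
  have := hface 2
  have := Fintype.ofFinite {e // e ∈ S.faces ∧ e.card = 1 + 1}
  have := Fintype.ofFinite {t // t ∈ S.faces ∧ t.card = 2 + 1}
  -- The two ranks are $t$ and at least $V - 1$, so $t + V - 1 \le E$.
  have h := Matrix.rank_add_rank_le_card_of_mul_eq_zero
    (triangleEdgeMatrix_mul_edgeVertexMatrix (S := S))
  rw [hS.rank_triangleEdgeMatrix hconn hbd, ← Nat.card_eq_fintype_card,
    ← Nat.card_eq_fintype_card, hcount, hcount] at h
  have hV := card_vertices_le_rank_edgeVertexMatrix hconn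
  rw [← Nat.card_eq_fintype_card, Nat.card_coe_set_eq, ← faceCount_zero] at hV
  unfold eulerChar
  omega


end Homology

/-! ### Genus estimates and the conclusion -/

section Genus

variable {E : Type*} [NormedAddCommGroup E] [NormedSpace ℝ E] {S : SimplicialComplex ℝ E}

theorem faces_nonempty_of_space_nonempty (h : S.space.Nonempty) : S.faces.Nonempty := by
  obtain ⟨x, hx⟩ := h
  obtain ⟨s, hs, -⟩ := SimplicialComplex.mem_space_iff.1 hx
  exact ⟨s, hs⟩

theorem boundaryComplex_space_subset : (boundaryComplex S).space ⊆ S.space := by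
  intro x hx
  obtain ⟨s, ⟨hs, e, he, -, -, hse⟩, hxs⟩ := SimplicialComplex.mem_space_iff.1 hx
  exact S.convexHull_subset_space (S.down_closed he hse hs) hxs

theorem IsPLSurface.surfaceGenus_nonneg (hS : IsPLSurface S) (hconn : IsConnected S.space)
    (hb : IsConnected (boundaryComplex S).space) : 0 ≤ surfaceGenus S := by
  have h := hS.eulerChar_le_one (fun x hx y hy => reachable_of_isPreconnected hS.finite
    hconn.isPreconnected subset_rfl hx (S.vertices_subset_space hx) hy
    (S.vertices_subset_space hy)) (faces_nonempty_of_space_nonempty hb.nonempty)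
  have h' : (eulerChar S : ℝ) ≤ 1 := by exact_mod_cast h
  rw [surfaceGenus, boundaryComponents_eq_one hb]
  push_cast
  linarith

/-- A surface with connected boundary has at least `4 g + 1` triangles, where `g` is computed
from its Euler characteristic. -/
theorem IsPLSurface.four_mul_surfaceGenus_add_one_le (hS : IsPLSurface S)
    (hb : IsConnected (boundaryComplex S).space) :
    4 * surfaceGenus S + 1 ≤ (triangleCount S : ℝ) := by
  have h1 := hS.three_mul_triangleCount_add
  have h2 := hS.boundaryEdgeCount_le
  have h3 := hS.three_le_faceCount_zero
    (faces_nonempty_of_space_nonempty (hb.nonempty.mono boundaryComplex_space_subset))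
  have h1' : 3 * (triangleCount S : ℝ) + boundaryEdgeCount S = 2 * faceCount S 1 := by
    exact_mod_cast h1
  have h2' : (boundaryEdgeCount S : ℝ) ≤ faceCount S 0 := by exact_mod_cast h2
  have h3' : (3 : ℝ) ≤ faceCount S 0 := by exact_mod_cast h3
  rw [surfaceGenus, boundaryComponents_eq_one hb, eulerChar]
  rw [triangleCount] at *
  push_cast
  -- $4g + 1 = t + b - 2V + 3 \le t - V + 3 \le t$.
  linarith

theorem triangleCount_componentComplex_le (hfin : S.faces.Finite) (v : E) :
    triangleCount (componentComplex S v) ≤ triangleCount S :=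
  Set.ncard_le_ncard (fun _ h => ⟨h.1.1, h.2⟩) (hfin.subset fun _ h => h.1)

theorem IsSubdivisionOf.isConnected_space {n : ℕ} {P : Polygon E n} (hP : IsEmbeddedPolygon P)
    (hb : IsSubdivisionOf S P) : IsConnected S.space :=
  hb.1 ▸ hP.isConnected_boundary

end Genus

theorem knotGenus_le {n : ℕ} {P : Polygon (EuclideanSpace ℝ (Fin 3)) n}
    (hP : IsEmbeddedPolygon P) {S : SimplicialComplex ℝ (EuclideanSpace ℝ (Fin 3))}
    (hS : IsPLSurface S) (hconn : IsConnected S.space) (ho : ∃ o, IsOrientation S o)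
    (hb : IsSubdivisionOf (boundaryComplex S) P) : knotGenus P ≤ surfaceGenus S := by
  -- `S` competes with $Q = P$ and the constant isotopy; nonnegativity of the genus gives the lower
  -- bound 0.
  refine csInf_le ⟨0, ?_⟩ ⟨n, P, S, hP, AmbientIsotopic.refl _, hS, hconn, ho, hb, rfl⟩
  rintro g ⟨m, Q, T, hQ, -, hT, hTconn, -, hTb, rfl⟩
  exact hT.surfaceGenus_nonneg hTconn (hTb.isConnected_space hQ)

theorem lemma3p1 {n : ℕ} (P : Polygon (EuclideanSpace ℝ (Fin 3)) n) (hP : IsEmbeddedPolygon P)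
    (S : Geometry.SimplicialComplex ℝ (EuclideanSpace ℝ (Fin 3))) (hS : IsPLSurface S)
    (o : Finset (EuclideanSpace ℝ (Fin 3)) → Equiv.Perm (EuclideanSpace ℝ (Fin 3)))
    (ho : IsOrientation S o) (hb : IsSubdivisionOf (boundaryComplex S) P) :
    4 * knotGenus P + 1 ≤ (triangleCount S : ℝ) := by
  have hconn : IsConnected (boundaryComplex S).space := hb.isConnected_space hP
  obtain ⟨s, hs⟩ := faces_nonempty_of_space_nonempty hconn.nonempty
  obtain ⟨v, hvs⟩ := SimplicialComplex.nonempty_of_mem_faces hs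
  have hv : v ∈ (boundaryComplex S).vertices := mem_vertices_of_mem hs hvs
  have hvertex : ∀ x ∈ (boundaryComplex S).vertices, x ∈ S.vertices := by
    rintro x ⟨hx, e, he, -, -, hxe⟩
    exact S.down_closed he hxe hx
  -- The boundary is connected, so the component of one of its vertices contains all of it.
  have hbd := boundaryComplex_componentComplex (S := S) (v := v) fun x hx =>
    reachable_of_isPreconnected hS.finite hconn.isPreconnected boundaryComplex_space_subset
      (hvertex v hv) (SimplicialComplex.vertices_subset_space hv)
      (hvertex x hx) (SimplicialComplex.vertices_subset_space hx)
  have hgenus := knotGenus_le hP (hS.componentComplex v)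
    (isConnected_space_componentComplex (hvertex v hv)) ⟨o, ho.componentComplex v⟩ (by rwa [hbd])
  have hcount := (hS.componentComplex v).four_mul_surfaceGenus_add_one_le (by rwa [hbd])
  have hle : (triangleCount (componentComplex S v) : ℝ) ≤ triangleCount S := by
    exact_mod_cast triangleCount_componentComplex_le hS.finite v
  linarith
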